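/- Throughout, all measures are on $\mathbb R$, $\mathcal L$ is Lebesgue measure, and for a Lebesgue measurable set $E$ with $0<\mathcal L(E)<\infty$, $\mathcal L_E$ denotes the normalized Lebesgue measure $\mathcal L_E(F)=\mathcal L(E\cap F)/\mathcal L(E)$. A Borel measure $\mu$ is *spectral* if there is a countable set $\Lambda\subset\mathbb R$ such that $\{e^{2\pi i\lambda x}:\lambda\in\Lambda\}$ is an orthonormal basis of $L^2(\mu)$. A measurable set $\Omega$ of finite positive Lebesgue measure is a *spectral set* if $\mathcal L_\Omega$ is spectral. A set $\Omega$ is a *translational tile* if there is a discrete set $\mathcal J\subset\mathbb R$ such that $\bigcup_{t\in\mathcal J}(\Omega+t)=\mathbb R$ up to a Lebesgue null set and $\mathcal L((\Omega+t)\cap(\Omega+t'))=0$ for all distinct $t,t'\in\mathcal J$. A measurable set $Q$ is a *fundamental domain* of a (full-rank) lattice $\Gamma\subset\mathbb R$ if the translates $Q+\gamma$, $\gamma\in\Gamma$, cover $\mathbb R$ up to a null set and any two distinct ones intersect in a null set. **Generalized Fuglede conjecture.** A compactly supported Borel probability measure $\mu$ on $\mathbb R$ is spectral if and only if there exist a Borel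 probability measure $\nu$ on $\mathbb R$ and a fundamental domain $Q$ of some lattice in $\mathbb R$ such that $\mu*\nu=\mathcal L_Q$. **Fuglede's conjecture on $\mathbb R$.** A bounded measurable set $\Omega\subset\mathbb R$ of positive Lebesgue measure is a spectral set if and only if it is a translational tile. **Theorem.** If the generalized Fuglede conjecture holds, then Fuglede's conjecture on $\mathbb R$ holds. -/

import Mathlib

open MeasureTheory

/-- The normalized Lebesgue measure `𝓛_E`, that is `F ↦ 𝓛(E ∩ F) / 𝓛(E)`. -/
noncomputable def normalizedLebesgue (E : Set ℝ) : Measure ℝ :=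
  ProbabilityTheory.cond volume E

/-- A measure `μ` on `ℝ` is spectral if there is a countable set `L` such that the exponentials
`x ↦ e^{2πi l x}`, `l ∈ L`, form an orthonormal basis of the complex Hilbert space `L²(μ)`. -/
def IsSpectralMeasure (μ : Measure ℝ) : Prop :=
  ∃ L : Set ℝ, L.Countable ∧ ∃ b : HilbertBasis L ℂ (Lp ℂ 2 μ),
    ∀ l : L, (b l : ℝ → ℂ) =ᵐ[μ]
      fun x : ℝ => Complex.exp (2 * Real.pi * Complex.I * (l : ℝ) * x)

/-- A (Lebesgue) measurable set of finite positive Lebesgue measure is a spectral set if its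
normalized Lebesgue measure is spectral. -/
def IsSpectralSet (Ω : Set ℝ) : Prop :=
  NullMeasurableSet Ω volume ∧ 0 < volume Ω ∧ volume Ω < ⊤ ∧
    IsSpectralMeasure (normalizedLebesgue Ω)

/-- `Ω` is a translational tile: the translates `Ω + t`, `t` in some discrete set `J`, cover `ℝ`
up to a null set, and distinct translates overlap in a null set. -/
def IsTranslationalTile (Ω : Set ℝ) : Prop :=
  ∃ J : Set ℝ, IsDiscrete J ∧
    volume (⋃ t ∈ J, (fun x => x + t) '' Ω)ᶜ = 0 ∧
    ∀ t ∈ J, ∀ t' ∈ J, t ≠ t' →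
      volume (((fun x => x + t) '' Ω) ∩ ((fun x => x + t') '' Ω)) = 0

/-- `Q` is a fundamental domain (in the measure-theoretic sense) of some full-rank lattice
of `ℝ`. -/
def IsLatticeFundamentalDomain (Q : Set ℝ) : Prop :=
  ∃ (Γ : Submodule ℤ ℝ) (_ : DiscreteTopology Γ), IsZLattice ℝ Γ ∧
    IsAddFundamentalDomain Γ Q volume

/-- The generalized Fuglede conjecture on `ℝ`: a compactly supported Borel probability measure
`μ` is spectral iff `μ ∗ ν = 𝓛_Q` for some Borel probability measure `ν` and some fundamental
domain `Q` of some lattice. -/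
def GeneralizedFugledeConjecture : Prop :=
  ∀ μ : Measure ℝ, IsProbabilityMeasure μ → IsCompact μ.support →
    (IsSpectralMeasure μ ↔
      ∃ (ν : Measure ℝ) (Q : Set ℝ), IsProbabilityMeasure ν ∧ IsLatticeFundamentalDomain Q ∧
        μ.conv ν = normalizedLebesgue Q)

/-- The classical Fuglede conjecture on `ℝ`: a bounded (Lebesgue) measurable set of positive
measure is a spectral set iff it is a translational tile. -/
def FugledeConjecture : Prop :=
  ∀ Ω : Set ℝ, Bornology.IsBounded Ω → NullMeasurableSet Ω volume → 0 < volume Ω →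
    (IsSpectralSet Ω ↔ IsTranslationalTile Ω)

/-! For bounded `Ω` of positive measure, the generalized conjecture says that `𝓛_Ω` is spectral iff
`𝓛_Ω ∗ ν = 𝓛_Q` for some probability measure `ν` and lattice fundamental domain `Q`. It therefore
suffices to show that such a factorization exists iff `Ω` tiles.

From factorization to tile: `x ↦ ν {y | x - y ∈ Ω}` is, up to a factor, the density of `𝓛_Ω ∗ ν`, so
almost everywhere it is `0` or a constant `c`. At its left end `ν` must carry an atom of mass
exactly `c` (`exists_measure_singleton_eq`). Removing the atom preserves the two-value property, so
`ν` is a finite sum of equal atoms (`exists_eq_sum_dirac`). Hence `Q` is an essentially disjoint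
union of translates `Ω + t`, `t ∈ T`, and `T + Γ` tiles.

From tile to factorization: some pattern of `J` on a window as long as `Ω` recurs exactly after a
shift `τ` (`exists_recurrent_window`). Compactness only gives approximate recurrence;
`eq_of_partition_of_close` makes it exact. With `T` the part of `J` in one period, `T + τℤ` is again
a tiling, so `Ω + T` is a fundamental domain of `τℤ` and `ν` can be uniform on `T`. The set `J`
itself need not be periodic. -/

open Set Filter Topology

open scoped ENNReal

/-! ### Normalizing `Ω` up to null sets. -/

/-- A measurable set contained in `[α, β]` whose essential infimum is `α` and whose essential
supremum is `β`. -/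
structure HasEssBounds (Ω : Set ℝ) (α β : ℝ) : Prop where
  measurableSet : MeasurableSet Ω
  subset : Ω ⊆ Icc α β
  left : ∀ y, α < y → 0 < volume (Ω ∩ Iio y)
  right : ∀ y, y < β → 0 < volume (Ω ∩ Ioi y)

/-- Intersecting with the support of the restricted measure discards only a null set. The support is
compact, so its extreme points belong to it and every neighbourhood of them has positive mass. -/
theorem exists_hasEssBounds {Ω : Set ℝ} (hb : Bornology.IsBounded Ω)
    (hm : NullMeasurableSet Ω volume) (hpos : 0 < volume Ω) :
    ∃ (Ω' : Set ℝ) (α β : ℝ), Ω' =ᵐ[volume] Ω ∧ HasEssBounds Ω' α β := by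
  obtain ⟨Ω₁, hsub, hm₁, he₁⟩ := hm.exists_measurable_subset_ae_eq
  set K := (volume.restrict Ω₁).support with hK
  have hKc : IsClosed K := Measure.isClosed_support
  have hne : K.Nonempty := Measure.nonempty_support (by
    rw [Ne, Measure.restrict_eq_zero, measure_congr he₁]; exact hpos.ne')
  have hKsub : K ⊆ closure Ω₁ := Measure.support_subset_of_isClosed isClosed_closure
    (mem_of_superset (self_mem_ae_restrict hm₁) subset_closure)
  have hKb : Bornology.IsBounded K := ((hb.subset hsub).closure).subset hKsub
  have hα := hKc.csInf_mem hne hKb.bddBelow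
  have hβ := hKc.csSup_mem hne hKb.bddAbove
  have hnull : volume (Ω₁ \ K) = 0 := by
    have : (volume.restrict Ω₁) Kᶜ = 0 := Measure.measure_compl_support
    rwa [Measure.restrict_apply hKc.measurableSet.compl, inter_comm] at this
  have he : (Ω₁ ∩ K : Set ℝ) =ᵐ[volume] Ω₁ := by
    have : (Ω₁ ∩ K : Set ℝ) = Ω₁ \ (Ω₁ \ K) := by ext; simp
    rw [this]; exact sdiff_null_ae_eq_self hnull
  have key : ∀ x ∈ K, ∀ U ∈ 𝓝 x, MeasurableSet U → 0 < volume ((Ω₁ ∩ K) ∩ U) := by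
    intro x hx U hU hUm
    have := (Measure.mem_support_iff_forall x).1 hx U hU
    rw [Measure.restrict_apply hUm, inter_comm] at this
    have hU' : (Ω₁ ∩ K ∩ U : Set ℝ) =ᵐ[volume] (Ω₁ ∩ U : Set ℝ) := ae_eq_set_inter he .rfl
    exact this.trans_eq (measure_congr hU').symm
  exact ⟨Ω₁ ∩ K, sInf K, sSup K, he.trans he₁,
    ⟨hm₁.inter hKc.measurableSet, fun x hx => ⟨csInf_le hKb.bddBelow hx.2,
      le_csSup hKb.bddAbove hx.2⟩, fun y hy => key _ hα _ (Iio_mem_nhds hy) measurableSet_Iio,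
      fun y hy => key _ hβ _ (Ioi_mem_nhds hy) measurableSet_Ioi⟩⟩

namespace HasEssBounds

variable {Ω : Set ℝ} {α β : ℝ}

theorem volume_pos (h : HasEssBounds Ω α β) : 0 < volume Ω :=
  (h.left (α + 1) (by linarith)).trans_le (measure_mono inter_subset_left)

theorem volume_lt_top (h : HasEssBounds Ω α β) : volume Ω < ⊤ :=
  (measure_mono h.subset).trans_lt (by simp)

theorem le (h : HasEssBounds Ω α β) : α ≤ β := by
  obtain ⟨x, hx⟩ := nonempty_of_measure_ne_zero h.volume_pos.ne'
  exact (h.subset hx).1.trans (h.subset hx).2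

/-- An open interval longer than `β - α` that meets `[α, β]` meets `Ω` in positive measure. -/
theorem inter_Ioo_pos (h : HasEssBounds Ω α β) {a b : ℝ} (ha : a < β) (hb : α < b)
    (hab : β - α < b - a) : 0 < volume (Ω ∩ Ioo a b) := by
  rcases lt_or_ge a α with haα | haα
  · refine (h.left b hb).trans_le (measure_mono ?_)
    exact fun x hx => ⟨hx.1, haα.trans_le (h.subset hx.1).1, hx.2⟩
  · refine (h.right a ha).trans_le (measure_mono ?_)
    exact fun x hx => ⟨hx.1, hx.2, (h.subset hx.1).2.trans_lt (by linarith)⟩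

end HasEssBounds

/-! ### Tilings as almost everywhere packings and coverings. -/

/-- Translates of `Ω` by distinct elements of `J` overlap in null sets. -/
def IsAEPacking (Ω J : Set ℝ) : Prop :=
  ∀ t ∈ J, ∀ t' ∈ J, t ≠ t' → ∀ᵐ x, ¬ (x - t ∈ Ω ∧ x - t' ∈ Ω)

/-- The translates of `Ω` by the elements of `J` cover almost every point. -/
def IsAECovering (Ω J : Set ℝ) : Prop := ∀ᵐ x, ∃ t ∈ J, x - t ∈ Ω

theorem image_add_right_eq (Ω : Set ℝ) (t : ℝ) :
    (fun x => x + t) '' Ω = {x | x - t ∈ Ω} := by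
  ext x; simp [sub_eq_add_neg]

theorem quasiMeasurePreserving_sub_right (t : ℝ) :
    Measure.QuasiMeasurePreserving (fun x : ℝ => x - t) volume volume :=
  (measurePreserving_sub_right volume t).quasiMeasurePreserving

theorem volume_translate (Ω : Set ℝ) (t : ℝ) : volume {x | x - t ∈ Ω} = volume Ω :=
  (measurePreserving_sub_right volume t).measure_preimage_equiv (f := MeasurableEquiv.subRight t) Ω

theorem isTranslationalTile_iff (Ω : Set ℝ) : IsTranslationalTile Ω ↔
    ∃ J : Set ℝ, IsDiscrete J ∧ IsAECovering Ω J ∧ IsAEPacking Ω J := by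
  unfold IsTranslationalTile IsAECovering IsAEPacking
  refine exists_congr fun J => and_congr Iff.rfl (and_congr ?_ ?_)
  · rw [ae_iff]
    have : (⋃ t ∈ J, (fun x => x + t) '' Ω)ᶜ = {x | ¬ ∃ t ∈ J, x - t ∈ Ω} := by
      ext x; simp [sub_eq_add_neg]
    rw [this]
  · refine forall₂_congr fun t _ => forall₃_congr fun t' _ _ => ?_
    rw [image_add_right_eq, image_add_right_eq, ae_iff]
    simp only [not_not]; rfl

theorem isDiscrete_of_finite_inter_Icc {J : Set ℝ} (h : ∀ a b, (J ∩ Icc a b).Finite) :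
    IsDiscrete J := by
  refine ⟨discreteTopology_subtype_iff.2 fun x hx => ?_⟩
  have hfin : ((J ∩ Icc (x - 1) (x + 1)) \ {x}).Finite := (h _ _).subset sdiff_subset
  have h1 : ((J ∩ Icc (x - 1) (x + 1)) \ {x})ᶜ ∈ 𝓝 x :=
    hfin.isClosed.isOpen_compl.mem_nhds (by simp)
  have h2 : Icc (x - 1) (x + 1) ∈ 𝓝 x := Icc_mem_nhds (by linarith) (by linarith)
  rw [← disjoint_iff, disjoint_principal_right, mem_nhdsWithin_iff_exists_mem_nhds_inter]
  refine ⟨_, inter_mem h1 h2, ?_⟩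
  rintro y ⟨⟨hy1, hy2⟩, hy3⟩ hyJ
  exact hy1 ⟨⟨hyJ, hy2⟩, hy3⟩

/-- Volume count: the translates are essentially disjoint and lie in an interval of length `w + (β -
α)`. The bound is uniform in `a`, as the later pigeonhole argument requires. -/
theorem IsAEPacking.card_le {Ω J : Set ℝ} {α β : ℝ} (hΩ : HasEssBounds Ω α β)
    (hJ : IsAEPacking Ω J) {a w : ℝ} (hw : 0 ≤ w) {F : Finset ℝ} (hF : ↑F ⊆ J ∩ Icc a (a + w)) :
    F.card ≤ ⌊(w + (β - α)) / volume.real Ω⌋₊ := by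
  have hpos : 0 < volume.real Ω := ENNReal.toReal_pos hΩ.volume_pos.ne' hΩ.volume_lt_top.ne
  refine Nat.le_floor ?_
  rw [le_div_iff₀ hpos]
  have h1 : volume (⋃ t ∈ F, {x | x - t ∈ Ω}) = ∑ t ∈ F, volume {x | x - t ∈ Ω} := by
    refine measure_biUnion_finset₀ ?_ ?_
    · intro t ht t' ht' hne
      have := hJ t (hF ht).1 t' (hF ht').1 hne
      rw [ae_iff] at this
      simp only [not_not] at this
      exact this
    · intro t _
      exact ((measurable_id.sub_const t) hΩ.measurableSet).nullMeasurableSet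
  have h2 : (⋃ t ∈ F, {x | x - t ∈ Ω}) ⊆ Icc (a + α) (a + w + β) := by
    intro x hx
    simp only [mem_iUnion, mem_ofPred_eq] at hx
    obtain ⟨t, ht, hx⟩ := hx
    have h3 := hΩ.subset hx
    have h4 := (hF ht).2
    simp only [mem_Icc] at h3 h4 ⊢
    constructor <;> linarith
  have h3 := measure_mono (μ := volume) h2
  rw [h1] at h3
  simp only [volume_translate, Finset.sum_const, Real.volume_Icc, nsmul_eq_mul] at h3
  have h4 := ENNReal.toReal_mono ENNReal.ofReal_ne_top h3
  rw [ENNReal.toReal_mul, ENNReal.toReal_natCast,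
    ENNReal.toReal_ofReal (by linarith [hΩ.le])] at h4
  calc _ ≤ _ := h4
    _ = _ := by ring

theorem IsAEPacking.finite_inter_Icc {Ω J : Set ℝ} {α β : ℝ} (hΩ : HasEssBounds Ω α β)
    (hJ : IsAEPacking Ω J) (a b : ℝ) : (J ∩ Icc a b).Finite := by
  rcases le_or_gt a b with hab | hab
  · by_contra hinf
    obtain ⟨F, hF, hc⟩ := Set.Infinite.exists_subset_card_eq hinf
      (⌊((b - a) + (β - α)) / volume.real Ω⌋₊ + 1)
    have := hJ.card_le hΩ (a := a) (w := b - a) (by linarith) (F := F) (by simpa using hF)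
    omega
  · simp [Icc_eq_empty_of_lt hab]

theorem isDiscrete_of_isAEPacking {Ω J : Set ℝ} {α β : ℝ} (hΩ : HasEssBounds Ω α β)
    (hJ : IsAEPacking Ω J) : IsDiscrete J :=
  isDiscrete_of_finite_inter_Icc (hJ.finite_inter_Icc hΩ)

/-- Being a translational tile depends only on the almost everywhere class of the set. -/
theorem isTranslationalTile_congr {Ω Ω' : Set ℝ} (h : Ω =ᵐ[volume] Ω')
    (hΩ : IsTranslationalTile Ω) : IsTranslationalTile Ω' := by
  obtain ⟨J, hd, hc, hp⟩ := (isTranslationalTile_iff Ω).1 hΩ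
  have ht : ∀ t, ∀ᵐ x, (x - t ∈ Ω ↔ x - t ∈ Ω') := fun t =>
    (quasiMeasurePreserving_sub_right t).ae h.mem_iff
  have := hd.to_subtype
  -- A discrete subset of `ℝ` is countable, so the null sets of all translates can be united.
  have hJ : J.Countable := TopologicalSpace.separableSpace_iff_countable.1 inferInstance
  refine (isTranslationalTile_iff Ω').2 ⟨J, hd, ?_, fun t hJt t' hJt' hne => ?_⟩
  · have := (ae_ball_iff hJ).2 fun t (_ : t ∈ J) => ht t
    filter_upwards [hc, this] with x ⟨t, hJt, hx⟩ h2
    exact ⟨t, hJt, (h2 t hJt).1 hx⟩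
  · filter_upwards [hp t hJt t' hJt' hne, ht t, ht t'] with x h1 h2 h3
    rwa [← h2, ← h3]

/-! ### Rigidity of nearby partitions of unity. -/

section Rigidity

variable {g : ℝ → ℝ}

/-- Almost every point where `g = 1` is a two-sided density point of `g`. -/
theorem ae_density_one (hg : LocallyIntegrable g volume) :
    ∀ᵐ x, g x = 1 → ∃ ε > 0, ∀ r, 0 < r → r ≤ ε →
      ∫ y in (x - r)..(x + r), (1 - g y) ≤ r / 8 := by
  have hgi : ∀ a b, IntervalIntegrable g volume a b := fun a b =>
    intervalIntegrable_iff.mpr <|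
      (hg.integrableOn_isCompact isCompact_uIcc).mono_set uIoc_subset_uIcc
  filter_upwards [LocallyIntegrable.ae_hasDerivAt_integral hg] with x hx hx1
  have hd := hx 0
  rw [hx1, hasDerivAt_iff_isLittleO] at hd
  -- An error of `r / 16` on each side of `x` adds up to `r / 8`.
  have h16 := hd.def (c := 1 / 16) (by norm_num)
  rw [Metric.eventually_nhds_iff_ball] at h16
  obtain ⟨ε, hε, hb⟩ := h16
  refine ⟨ε / 2, by positivity, fun r hr hrε => ?_⟩
  have h1 := hb (x + r) (by simp [abs_of_pos hr]; linarith)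
  have h2 := hb (x - r) (by simp [abs_of_pos hr]; linarith)
  simp only [smul_eq_mul, mul_one, Real.norm_eq_abs] at h1 h2
  rw [intervalIntegral.integral_interval_sub_left (hgi _ _) (hgi _ _)] at h1 h2
  have e1 : x + r - x = r := by ring
  have e2 : x - r - x = -r := by ring
  rw [e1, abs_of_pos hr] at h1
  rw [e2, abs_neg, abs_of_pos hr, intervalIntegral.integral_symm] at h2
  have h3 := neg_le_of_abs_le h1
  have h4 := le_of_abs_le h2
  rw [intervalIntegral.integral_sub (by simp) (hgi _ _),
    ← intervalIntegral.integral_add_adjacent_intervals (hgi (x - r) x) (hgi x (x + r))]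
  simp only [intervalIntegral.integral_const, smul_eq_mul, mul_one]
  linarith

/-- Two systems of translates of `g` which both form a partition of unity on an interval and are
sufficiently close to each other differ by a translation only. -/
theorem eq_of_partition_of_close {ι : Type*} [Fintype ι] [DecidableEq ι]
    (hg : LocallyIntegrable g volume) (hg0 : ∀ x, 0 ≤ g x) (hg1 : ∀ x, g x ≤ 1)
    {u v q : ι → ℝ} {A B ε : ℝ}
    (hu : ∀ᵐ x, x ∈ Ioo A B → ∑ i, g (x - u i) = 1)
    (hv : ∀ᵐ x, x ∈ Ioo A B → ∑ i, g (x - v i) = 1)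
    (hq : ∀ i r, 0 < r → r ≤ ε → ∫ y in (q i - r)..(q i + r), (1 - g y) ≤ r / 8)
    (hA : ∀ i, A < q i + u i - ε) (hB : ∀ i, q i + u i + ε < B)
    (huv : ∀ i, |v i - u i| ≤ ε) {i₀ : ι} (h₀ : u i₀ = v i₀) : u = v := by
  have hgi : ∀ a b, IntervalIntegrable g volume a b := fun a b =>
    intervalIntegrable_iff.mpr <|
      (hg.integrableOn_isCompact isCompact_uIcc).mono_set uIoc_subset_uIcc
  have hgi' : ∀ c a b, IntervalIntegrable (fun y => g (y - c)) volume a b := fun c a b => by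
    simpa using (hgi (a - c) (b - c)).comp_sub_right c
  have : Nonempty ι := ⟨i₀⟩
  -- The largest displacement `r` is the scale at which the density points are used.
  obtain ⟨j, hj⟩ := Finite.exists_max fun i => |v i - u i|
  set r := |v j - u j| with hr
  rcases (abs_nonneg (v j - u j)).eq_or_lt with h0 | hrpos
  · funext i
    have := hj i
    rw [hr, ← h0] at this
    linarith [abs_eq_zero.1 (le_antisymm this (abs_nonneg _))]
  exfalso
  have hrε : r ≤ ε := huv j
  have hr0 : 0 ≤ r := hrpos.le
  have sum_int : ∀ w : ι → ℝ, (∀ᵐ x, x ∈ Ioo A B → ∑ i, g (x - w i) = 1) →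
      ∀ x ∈ Ioo A B, ∀ y ∈ Ioo A B, ∑ i, ∫ z in x..y, g (z - w i) = y - x := by
    intro w hw x hx y hy
    rw [← intervalIntegral.integral_finsetSum fun i _ => hgi' (w i) x y]
    have : ∫ z in x..y, ∑ i, g (z - w i) = ∫ z in x..y, (1 : ℝ) := by
      refine intervalIntegral.integral_congr_ae ?_
      filter_upwards [hw] with z hz hzm
      refine hz ?_
      have : uIcc x y ⊆ Ioo A B := (ordConnected_Ioo).uIcc_subset hx hy
      exact this (uIoc_subset_uIcc hzm)
    rw [this]; simp
  -- `G` compares the two systems. When `x` moves, it changes by the difference of the two total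
  -- masses swept, which are equal; so it is constant on the window.
  set G : ℝ → ℝ := fun x => ∑ i, ∫ z in (x - v i)..(x - u i), g z with hG
  have hGconst : ∀ x ∈ Ioo A B, ∀ y ∈ Ioo A B, G x = G y := by
    intro x hx y hy
    have h1 := sum_int u hu x hx y hy
    have h2 := sum_int v hv x hx y hy
    simp only [intervalIntegral.integral_comp_sub_right] at h1 h2
    rw [← sub_eq_zero, hG]
    simp only
    rw [← Finset.sum_sub_distrib]
    have h3 : ∀ i, (∫ z in (x - v i)..(x - u i), g z) - (∫ z in (y - v i)..(y - u i), g z)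
        = (∫ z in (x - v i)..(y - v i), g z) - ∫ z in (x - u i)..(y - u i), g z := by
      intro i
      exact intervalIntegral.integral_interval_sub_interval_comm' (hgi _ _) (hgi _ _) (hgi _ _) |>.trans
        (by rw [intervalIntegral.integral_symm (y - v i) (x - v i),
          intervalIntegral.integral_symm (y - u i) (x - u i)]; ring)
    rw [Finset.sum_congr rfl fun i _ => h3 i, Finset.sum_sub_distrib, h1, h2, sub_self]
  have hmem : ∀ i, ∀ s, |s| ≤ r → q i + u i + s ∈ Ioo A B := fun i s hs =>
    ⟨by linarith [hA i, (abs_le.1 hs).1], by linarith [hB i, (abs_le.1 hs).2]⟩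
  have mono : ∀ f : ℝ → ℝ, (∀ a b, IntervalIntegrable f volume a b) → (∀ x, 0 ≤ f x) →
      ∀ c a b, |a - c| ≤ r → |b - c| ≤ r →
        |∫ z in a..b, f z| ≤ ∫ z in (c - r)..(c + r), f z := by
    intro f hf hf0 c a b ha hb
    rw [abs_le] at ha hb
    have h1 : uIoc a b ⊆ uIoc (c - r) (c + r) := by
      rw [uIoc_of_le (a := c - r) (by linarith)]
      intro z hz
      rw [uIoc, mem_Ioc] at hz
      have : c - r ≤ min a b := le_min (by linarith) (by linarith)
      have : max a b ≤ c + r := max_le (by linarith) (by linarith)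
      exact ⟨by linarith, by linarith⟩
    have := intervalIntegral.abs_integral_mono_interval (μ := volume) h1
      (Eventually.of_forall hf0) (hf _ _)
    rwa [abs_of_nonneg (a := ∫ z in (c - r)..(c + r), f z)
      (intervalIntegral.integral_nonneg (by linarith) fun z _ => hf0 z)] at this
  -- Near the density point `q k`, the `k`-th translate takes almost all of the unit mass. Its term
  -- is then nearly `v k - u k`, and the other terms are nearly zero. All displacements are thus
  -- within `r / 4` of one constant; one of them is `0` and one has size `r`, which is impossible.
  have est : ∀ k, |G (q k + u k) - (v k - u k)| ≤ r / 4 := by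
    intro k
    set x := q k + u k with hx
    have hdens := hq k r hrpos hrε
    have hxk : x - u k = q k := by rw [hx]; ring
    have h1 : |(∫ z in (x - v k)..(x - u k), g z) - (v k - u k)| ≤ r / 8 := by
      have e : (∫ z in (x - v k)..(x - u k), g z) - (v k - u k)
          = -∫ z in (x - v k)..(x - u k), (1 - g z) := by
        rw [intervalIntegral.integral_sub (by simp) (hgi _ _)]
        simp
      rw [e, abs_neg]
      refine (mono (fun z => 1 - g z) (fun a b => (by simp : IntervalIntegrable (fun _ => (1 : ℝ))
        volume a b).sub (hgi a b)) (fun z => sub_nonneg.2 (hg1 z)) (q k) _ _ ?_ ?_).trans hdens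
      · rw [hx]
        have : q k + u k - v k - q k = -(v k - u k) := by ring
        rw [this, abs_neg]; exact hj k
      · rwa [hxk, sub_self, abs_zero]
    have h2 : ∑ i ∈ Finset.univ.erase k, |∫ z in (x - v i)..(x - u i), g z| ≤ r / 8 := by
      have h3 : ∀ i, |∫ z in (x - v i)..(x - u i), g z|
          ≤ ∫ z in (x - r)..(x + r), g (z - u i) := by
        intro i
        refine (mono g hgi hg0 (x - u i) _ _ ?_ ?_).trans_eq ?_
        · have : x - v i - (x - u i) = -(v i - u i) := by ring
          rw [this, abs_neg]; exact hj i
        · rwa [sub_self, abs_zero]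
        · rw [intervalIntegral.integral_comp_sub_right]; congr 1 <;> ring
      have h4 := sum_int u hu (x - r) (by
        simpa [sub_eq_add_neg] using hmem k (-r) (by rw [abs_neg, abs_of_pos hrpos]))
        (x + r) (hmem k r (by rw [abs_of_pos hrpos]))
      rw [← Finset.add_sum_erase _ _ (Finset.mem_univ k)] at h4
      have h5 : ∫ z in (x - r)..(x + r), g (z - u k) = ∫ z in (q k - r)..(q k + r), g z := by
        rw [intervalIntegral.integral_comp_sub_right]; congr 1 <;> linarith
      rw [intervalIntegral.integral_sub (by simp) (hgi _ _)] at hdens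
      simp only [intervalIntegral.integral_const, smul_eq_mul, mul_one] at hdens
      have h6 := Finset.sum_le_sum (s := Finset.univ.erase k) fun i _ => h3 i
      linarith
    have h7 : G x = (∫ z in (x - v k)..(x - u k), g z)
        + ∑ i ∈ Finset.univ.erase k, ∫ z in (x - v i)..(x - u i), g z :=
      (Finset.add_sum_erase _ _ (Finset.mem_univ k)).symm
    have h8 := (Finset.abs_sum_le_sum_abs (fun i => ∫ z in (x - v i)..(x - u i), g z)
      (Finset.univ.erase k)).trans h2
    rw [h7, abs_le]
    rw [abs_le] at h1 h8
    constructor <;> linarith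
  have e0 := est i₀
  have ej := est j
  rw [hGconst _ (by simpa using hmem i₀ 0 (by rwa [abs_zero])) _
    (by simpa using hmem j 0 (by rwa [abs_zero])), h₀, sub_self, sub_zero] at e0
  have := abs_sub_abs_le_abs_sub (v j - u j) (G (q j + u j))
  rw [abs_sub_comm] at ej
  rw [← hr] at this
  linarith

end Rigidity

/-! ### Exact recurrence of a window in a tiling. -/

theorem exists_fin_enumeration {γ : Type*} (F : Finset γ) {a : γ} (ha : a ∈ F) :
    ∃ g : Fin (F.card - 1 + 1) → γ, Function.Injective g ∧ range g = F ∧ g 0 = a := by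
  have hc : F.card - 1 + 1 = F.card := Nat.sub_add_cancel (Finset.card_pos.2 ⟨a, ha⟩)
  let e : Fin (F.card - 1 + 1) ≃ F := (finCongr hc).trans F.equivFin.symm
  let σ := Equiv.swap 0 (e.symm ⟨a, ha⟩)
  refine ⟨fun i => e (σ i), fun i j hij => σ.injective (e.injective (Subtype.ext hij)), ?_, ?_⟩
  · ext x
    constructor
    · rintro ⟨i, rfl⟩; exact (e (σ i)).2
    · intro hx; exact ⟨σ.symm (e.symm ⟨x, hx⟩), by simp⟩
  · simp [σ]

variable {Ω J : Set ℝ} {α β : ℝ}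

theorem IsAECovering.exists_ge (hΩ : HasEssBounds Ω α β) (hc : IsAECovering Ω J) (R : ℝ) :
    ∃ t ∈ J, R ≤ t := by
  have hpos : volume (Ioo (R + β) (R + β + 1)) ≠ 0 := by simp
  obtain ⟨x, hx, t, ht, hxt⟩ := (frequently_ae_mem_iff.2 hpos).and_eventually hc |>.exists
  exact ⟨t, ht, by linarith [(hΩ.subset hxt).2, hx.1]⟩

theorem locallyIntegrable_indicator_one (hΩ : MeasurableSet Ω) :
    LocallyIntegrable (Ω.indicator (1 : ℝ → ℝ)) volume :=
  (locallyIntegrable_const (1 : ℝ)).indicator hΩ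

/-- If finitely many points of `J` contain all those points whose translates of `Ω` meet a given
interval, these translates form a partition of unity on the interval. -/
theorem sum_indicator_eq_one (hc : IsAECovering Ω J) (hp : IsAEPacking Ω J) {ι : Type*} [Fintype ι]
    {u : ι → ℝ} (hu : Function.Injective u) {s A B : ℝ} (huJ : ∀ i, u i + s ∈ J)
    (hJ : ∀ x ∈ Ioo A B, ∀ t ∈ J, x + s - t ∈ Ω → ∃ i, u i + s = t) :
    ∀ᵐ x, x ∈ Ioo A B → ∑ i, Ω.indicator (1 : ℝ → ℝ) (x - u i) = 1 := by
  classical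
  have hs := (measurePreserving_add_right volume s).quasiMeasurePreserving
  have h1 : ∀ i j, i ≠ j → ∀ᵐ x, ¬ (x - u i ∈ Ω ∧ x - u j ∈ Ω) := fun i j hij => by
    filter_upwards [hs.ae (hp _ (huJ i) _ (huJ j) fun h => hij (hu (add_right_cancel h)))] with x hx
    simpa using hx
  have h2 : ∀ᵐ x, ∀ i j, i ≠ j → ¬ (x - u i ∈ Ω ∧ x - u j ∈ Ω) :=
    ae_all_iff.2 fun i => ae_all_iff.2 fun j => by
      by_cases hij : i = j
      · simp [hij]
      · filter_upwards [h1 i j hij] with x hx _ using hx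
  filter_upwards [h2, hs.ae hc] with x hx ⟨t, ht, hxt⟩ hxA
  obtain ⟨i, rfl⟩ := hJ x hxA t ht hxt
  have hi : x - u i ∈ Ω := by simpa using hxt
  rw [Finset.sum_eq_single i]
  · simp [hi]
  · intro j _ hj
    exact indicator_of_notMem (fun h => hx j i hj ⟨h, hi⟩) _
  · simp

/-- In a tiling by translates of `Ω`, some window of length `β - α` recurs exactly. -/
theorem exists_recurrent_window (hΩ : HasEssBounds Ω α β) (hc : IsAECovering Ω J)
    (hp : IsAEPacking Ω J) :
    ∃ a ∈ J, ∃ τ, 0 < τ ∧ β - α ≤ τ ∧ ∀ s, -(β - α) ≤ s → s < 0 →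
      (s + a ∈ J ↔ s + (a + τ) ∈ J) := by
  classical
  have hL : 0 ≤ β - α := sub_nonneg.2 hΩ.le
  set L := β - α with hLdef
  choose nxt hnxtJ hnxt using hc.exists_ge hΩ
  -- Consecutive centres are at least `L + 1` apart, so any two of them give `τ > 0` and `τ ≥ L`.
  let t : ℕ → ℝ := fun n => n.rec (nxt 0) fun _ x => nxt (x + (L + 1))
  have htJ : ∀ n, t n ∈ J := fun n => by cases n <;> exact hnxtJ _
  have htstep : ∀ n, t n + (L + 1) ≤ t (n + 1) := fun n => hnxt _
  have htmono : Monotone t := monotone_nat_of_le_succ fun n => by linarith [htstep n]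
  have htlt : ∀ n m, n < m → t n + (L + 1) ≤ t m := fun n m h => (htstep n).trans (htmono h)
  set W := L + 3 with hW
  set N := ⌊(2 * W + (β - α)) / volume.real Ω⌋₊
  -- Index `0` is the centre: its offset is always `0`, which is the fixed index that rigidity
  -- needs.
  let P : ℕ → ℕ → Prop := fun n k => ∃ g : Fin (k + 1) → ℝ, Function.Injective g ∧
    range g = J ∩ Icc (t n - W) (t n + W) ∧ g 0 = t n
  have hP : ∀ n, ∃ k ∈ Finset.range (N + 1), P n k := by
    intro n
    have hfin := hp.finite_inter_Icc hΩ (t n - W) (t n + W)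
    have hmem : t n ∈ hfin.toFinset := by
      simp only [Finite.mem_toFinset, mem_inter_iff, mem_Icc]
      exact ⟨htJ n, by linarith, by linarith⟩
    obtain ⟨g, hg1, hg2, hg3⟩ := exists_fin_enumeration hfin.toFinset hmem
    have hcard : hfin.toFinset.card ≤ N := by
      refine hp.card_le hΩ (a := t n - W) (w := 2 * W) (by linarith) ?_
      rw [hfin.coe_toFinset]
      have : t n - W + 2 * W = t n + W := by ring
      rw [this]
    refine ⟨_, Finset.mem_range.2 (by omega), g, hg1, by rw [hg2, hfin.coe_toFinset], hg3⟩
  obtain ⟨k, hk⟩ : ∃ k, ∃ᶠ n in atTop, P n k := by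
    by_contra! hcon
    have h1 : ∀ᶠ n in atTop, ∀ k ∈ Finset.range (N + 1), ¬ P n k :=
      (Finset.eventually_all _).2 fun k _ => hcon k
    obtain ⟨n, hn⟩ := h1.exists
    obtain ⟨k, hk, hPk⟩ := hP n
    exact hn k hk hPk
  obtain ⟨φ, hφ, hPφ⟩ := extraction_of_frequently_atTop hk
  choose g hginj hgrange hg0 using hPφ
  let f : ℕ → Fin (k + 1) → ℝ := fun n i => g n i - t (φ n)
  have hgJ : ∀ n i, g n i ∈ J ∧ g n i ∈ Icc (t (φ n) - W) (t (φ n) + W) := fun n i => by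
    have : g n i ∈ range (g n) := mem_range_self i
    rw [hgrange] at this
    exact this
  have hfK : ∀ n, f n ∈ Set.pi univ fun _ : Fin (k + 1) => Icc (-W) W := fun n i _ => by
    have := (hgJ n i).2
    simp only [mem_Icc, f] at this ⊢
    constructor <;> linarith
  obtain ⟨l, -, ψ, hψ, hlim⟩ :=
    (isCompact_univ_pi fun _ : Fin (k + 1) => isCompact_Icc (a := -W) (b := W)).tendsto_subseq hfK
  rw [tendsto_pi_nhds] at hlim
  have hf0 : ∀ n, f n 0 = 0 := fun n => by simp [f, hg0]
  have hl0 : l 0 = 0 := by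
    refine tendsto_nhds_unique (hlim 0) ?_
    simp [hf0]
  -- The window ends avoid all limit offsets, so the set of indices inside it stabilizes. Its length
  -- exceeds `2 * L`, so after trimming by `L` every translate inside still meets the rest in
  -- positive measure.
  obtain ⟨a₁, ha₁, ha₁l⟩ := (Ioo_infinite (show -L - 1 < -L by linarith)).exists_notMem_finite
    (finite_range l)
  obtain ⟨b₁, hb₁, hb₁l⟩ := (Ioo_infinite (show L + 1 < L + 2 by linarith)).exists_notMem_finite
    (finite_range l)
  let S : Type := {i : Fin (k + 1) // l i ∈ Ioo a₁ b₁}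
  have hS0 : l 0 ∈ Ioo a₁ b₁ := by
    rw [hl0]; exact ⟨by linarith [ha₁.2], by linarith [hb₁.1]⟩
  -- On `(a₁ + β, b₁ + α)` only translates with offset in `(a₁, b₁)` are visible. The margin `2 * ε`
  -- absorbs both the radius `ε` and the distance of `f (ψ n) i` from `l i`.
  have hdens : ∀ i : S, ∃ q ε, 0 < ε ∧ a₁ + β + 2 * ε < q + l i ∧ q + l i + 2 * ε < b₁ + α ∧
      ∀ r, 0 < r → r ≤ ε →
        ∫ y in (q - r)..(q + r), (1 - Ω.indicator (1 : ℝ → ℝ) y) ≤ r / 8 := by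
    rintro ⟨i, hi⟩
    have hpos := hΩ.inter_Ioo_pos (a := a₁ + β - l i) (b := b₁ + α - l i)
      (by linarith [hi.1]) (by linarith [hi.2]) (by linarith [ha₁.2, hb₁.1])
    obtain ⟨q, ⟨hqΩ, hqI⟩, hq⟩ := (frequently_ae_mem_iff.2 hpos.ne').and_eventually
      (ae_density_one (locallyIntegrable_indicator_one hΩ.measurableSet)) |>.exists
    obtain ⟨ε, hε, hd⟩ := hq (by simp [hqΩ])
    have h1 : 0 < q + l i - (a₁ + β) := by linarith [hqI.1]
    have h2 : 0 < b₁ + α - (q + l i) := by linarith [hqI.2]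
    refine ⟨q, min ε (min ((q + l i - (a₁ + β)) / 3) ((b₁ + α - (q + l i)) / 3)),
      by positivity, ?_, ?_, fun r hr hrε => hd r hr (hrε.trans (min_le_left _ _))⟩
    · have := (min_le_right ε _).trans
        (min_le_left ((q + l i - (a₁ + β)) / 3) ((b₁ + α - (q + l i)) / 3))
      simp only; linarith
    · have := (min_le_right ε _).trans
        (min_le_right ((q + l i - (a₁ + β)) / 3) ((b₁ + α - (q + l i)) / 3))
      simp only; linarith
  choose q ε' hε' hqa hqb hqd using hdens
  have : Nonempty S := ⟨⟨0, hS0⟩⟩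
  have : Finite S := inferInstanceAs (Finite {i : Fin (k + 1) // l i ∈ Ioo a₁ b₁})
  have : Fintype S := Fintype.ofFinite S
  obtain ⟨i₀, hi₀⟩ := Finite.exists_min ε'
  set ε := ε' i₀ with hεdef
  have hε : 0 < ε := hε' i₀
  -- Two windows `ε / 2`-close to the limit are `ε`-close to each other.
  have hev : ∀ᶠ n in atTop, ∀ i, |f (ψ n) i - l i| < ε / 2 ∧
      (f (ψ n) i ∈ Ioo a₁ b₁ ↔ l i ∈ Ioo a₁ b₁) := by
    refine eventually_all.2 fun i => ?_
    have h1 := (Metric.tendsto_nhds.1 (hlim i)) (ε / 2) (by positivity)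
    refine (h1.mono fun n hn => by simpa [Real.dist_eq] using hn).and ?_
    by_cases hi : l i ∈ Ioo a₁ b₁
    · filter_upwards [(hlim i).eventually (isOpen_Ioo.mem_nhds hi)] with n hn
      simpa [hi] using hn
    · have hi' : l i ∈ (Icc a₁ b₁)ᶜ := fun h => hi ⟨h.1.lt_of_ne fun h' => ha₁l ⟨i, h'.symm⟩,
        h.2.lt_of_ne fun h' => hb₁l ⟨i, h'⟩⟩
      filter_upwards [(hlim i).eventually (isClosed_Icc.isOpen_compl.mem_nhds hi')] with n hn
      exact ⟨fun h => absurd (Ioo_subset_Icc_self h) hn, fun h => absurd h hi⟩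
  obtain ⟨M, hM⟩ := eventually_atTop.1 hev
  have hwin : ∀ n ≥ M, ∀ s ∈ Ioo a₁ b₁, s + t (φ (ψ n)) ∈ J → ∃ i : S, f (ψ n) i = s := by
    intro n hn s hs hsJ
    have : s + t (φ (ψ n)) ∈ range (g (ψ n)) := by
      rw [hgrange]
      exact ⟨hsJ, by linarith [hs.1, ha₁.1], by linarith [hs.2, hb₁.2]⟩
    obtain ⟨i, hi⟩ := this
    have hfi : f (ψ n) i = s := by simp [f, hi]
    exact ⟨⟨i, ((hM n hn i).2).1 (hfi ▸ hs)⟩, hfi⟩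
  have hpart : ∀ n ≥ M, ∀ᵐ x, x ∈ Ioo (a₁ + β) (b₁ + α) →
      ∑ i : S, Ω.indicator (1 : ℝ → ℝ) (x - f (ψ n) i) = 1 := by
    intro n hn
    refine sum_indicator_eq_one hc hp (s := t (φ (ψ n))) ?_ ?_ ?_
    · intro i j hij
      simp only [f, sub_left_inj] at hij
      exact Subtype.ext (hginj _ hij)
    · intro i
      simp only [f, sub_add_cancel]
      exact (hgJ _ _).1
    · intro x hx s hs hxs
      have h3 := hΩ.subset hxs
      obtain ⟨i, hi⟩ := hwin n hn (s - t (φ (ψ n)))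
        ⟨by linarith [h3.2, hx.1], by linarith [h3.1, hx.2]⟩ (by simpa using hs)
      exact ⟨i, by simp [hi]⟩
  have hclose : ∀ n ≥ M, ∀ i, l i - ε / 2 < f (ψ n) i ∧ f (ψ n) i < l i + ε / 2 := by
    intro n hn i
    have := abs_lt.1 (hM n hn i).1
    exact ⟨by linarith, by linarith⟩
  have heq := eq_of_partition_of_close (ι := S)
    (locallyIntegrable_indicator_one hΩ.measurableSet)
    (fun x => indicator_nonneg (by simp) x) (fun x => indicator_le_self' (by simp) x)
    (u := fun i => f (ψ M) i) (v := fun i => f (ψ (M + 1)) i) (q := q) (ε := ε)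
    (hpart M le_rfl) (hpart (M + 1) (by omega))
    (fun i r hr hrε => hqd i r hr (hrε.trans (hi₀ i)))
    (fun i => by linarith [hqa i, (hclose M le_rfl i).1, hi₀ i])
    (fun i => by linarith [hqb i, (hclose M le_rfl i).2, hi₀ i])
    (fun i => by
      have h1 := hclose M le_rfl i
      have h2 := hclose (M + 1) (by omega) i
      rw [abs_le]
      constructor <;> linarith) (i₀ := ⟨0, hS0⟩) (by simp [hf0])
  have hlt := htlt _ _ (hφ (hψ (Nat.lt_succ_self M)))
  refine ⟨t (φ (ψ M)), htJ _, t (φ (ψ (M + 1))) - t (φ (ψ M)), by linarith, by linarith,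
    fun s hs1 hs2 => ?_⟩
  have hs : s ∈ Ioo a₁ b₁ := ⟨by linarith [ha₁.2], by linarith [hb₁.1]⟩
  rw [add_sub_cancel]
  constructor
  · intro h
    obtain ⟨i, hi⟩ := hwin M le_rfl s hs h
    have := congrFun heq i
    simp only [hi] at this
    rw [this]
    simpa [f] using (hgJ (ψ (M + 1)) i).1
  · intro h
    obtain ⟨i, hi⟩ := hwin (M + 1) (by omega) s hs h
    have := congrFun heq i
    simp only [hi] at this
    rw [← this]
    simpa [f] using (hgJ (ψ M) i).1

/-! ### The density of `𝓛_Ω ∗ ν`. -/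

variable {ν : Measure ℝ} {c : ℝ≥0∞}

theorem measurableSet_sub_mem (hΩ : MeasurableSet Ω) :
    MeasurableSet {p : ℝ × ℝ | p.1 - p.2 ∈ Ω} :=
  (measurable_fst.sub measurable_snd) hΩ

theorem measurable_measure_sub_mem [SFinite ν] (hΩ : MeasurableSet Ω) :
    Measurable fun x => ν {y | x - y ∈ Ω} :=
  measurable_measure_prodMk_left (measurableSet_sub_mem hΩ)

/-- Tonelli for the set of pairs with `x - y ∈ Ω`. -/
theorem setLIntegral_measure_sub_mem [SFinite ν] (hΩ : MeasurableSet Ω) (E : Set ℝ) :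
    ∫⁻ x in E, ν {y | x - y ∈ Ω} = ∫⁻ y, volume ({x | x - y ∈ Ω} ∩ E) ∂ν := by
  have h1 := Measure.prod_apply (μ := volume.restrict E) (ν := ν) (measurableSet_sub_mem hΩ)
  rw [Measure.prod_apply_symm (measurableSet_sub_mem hΩ)] at h1
  refine h1.symm.trans (lintegral_congr fun y => ?_)
  exact Measure.restrict_apply ((measurable_id.sub_const y) hΩ)

theorem measurable_volume_translate_inter (hΩ : MeasurableSet Ω) (E : Set ℝ) :
    Measurable fun y => volume ({x | x - y ∈ Ω} ∩ E) := by
  convert measurable_measure_prodMk_right (μ := volume.restrict E)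
    (measurableSet_sub_mem hΩ) using 2 with y
  exact (Measure.restrict_apply ((measurable_id.sub_const y) hΩ)).symm

theorem conv_normalizedLebesgue_apply [SFinite ν] (hΩ : MeasurableSet Ω) {E : Set ℝ}
    (hE : MeasurableSet E) :
    ((normalizedLebesgue Ω).conv ν) E = (volume Ω)⁻¹ * ∫⁻ x in E, ν {y | x - y ∈ Ω} := by
  have hmeas : MeasurableSet ((fun p : ℝ × ℝ => p.1 + p.2) ⁻¹' E) := measurable_add hE
  have : SFinite (normalizedLebesgue Ω) := by unfold normalizedLebesgue; infer_instance
  rw [Measure.conv, Measure.map_apply measurable_add hE, Measure.prod_apply_symm hmeas,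
    setLIntegral_measure_sub_mem hΩ E, ← lintegral_const_mul _ (measurable_volume_translate_inter hΩ E)]
  refine lintegral_congr fun y => ?_
  rw [normalizedLebesgue, ProbabilityTheory.cond_apply hΩ]
  congr 1
  have : {x | x - y ∈ Ω} ∩ E = {x | x - y ∈ Ω ∩ {x | x + y ∈ E}} := by
    ext x; simp
  rw [this, volume_translate]
  rfl

theorem measure_sub_mem_ae_eq_of_conv_eq [IsProbabilityMeasure ν] (hΩ : HasEssBounds Ω α β)
    {Q : Set ℝ} (hQ : NullMeasurableSet Q) (h : (normalizedLebesgue Ω).conv ν = normalizedLebesgue Q) :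
    ∃ c : ℝ≥0∞, c ≠ 0 ∧ c ≠ ⊤ ∧ (fun x => ν {y | x - y ∈ Ω}) =ᵐ[volume] Q.indicator fun _ => c := by
  have h0 := hΩ.volume_pos.ne'
  have h1 := hΩ.volume_lt_top.ne
  have : IsProbabilityMeasure (normalizedLebesgue Ω) :=
    ProbabilityTheory.cond_isProbabilityMeasure_of_finite h0 h1
  have huniv : (normalizedLebesgue Q) univ = 1 := by rw [← h]; exact measure_univ
  rw [normalizedLebesgue, ProbabilityTheory.cond, Measure.smul_apply,
    Measure.restrict_apply_univ, smul_eq_mul] at huniv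
  have hQ0 : volume Q ≠ 0 := fun h => by simp [h] at huniv
  have hQ1 : volume Q ≠ ⊤ := fun h => by simp [h] at huniv
  refine ⟨volume Ω * (volume Q)⁻¹, mul_ne_zero h0 (ENNReal.inv_ne_zero.2 hQ1),
    ENNReal.mul_ne_top h1 (ENNReal.inv_ne_top.2 hQ0), ?_⟩
  refine ae_eq_of_forall_setLIntegral_eq_of_sigmaFinite₀
    (measurable_measure_sub_mem hΩ.measurableSet).aemeasurable
    (aemeasurable_const.indicator₀ hQ) fun E hE _ => ?_
  have h2 := conv_normalizedLebesgue_apply (ν := ν) hΩ.measurableSet hE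
  rw [h, normalizedLebesgue, ProbabilityTheory.cond, Measure.smul_apply, smul_eq_mul,
    Measure.restrict_apply hE] at h2
  rw [lintegral_indicator₀ (hQ.mono_ac Measure.absolutelyContinuous_restrict), lintegral_const,
    Measure.restrict_apply_univ, Measure.restrict_apply₀' (hs := hE.nullMeasurableSet), mul_assoc,
    inter_comm, h2, ← mul_assoc, ENNReal.mul_inv_cancel h0 h1, one_mul]

theorem conv_eq_of_measure_sub_mem_ae_eq [IsProbabilityMeasure ν] (hΩ : HasEssBounds Ω α β)
    {Q : Set ℝ} (hQ : NullMeasurableSet Q)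
    (h : (fun x => ν {y | x - y ∈ Ω}) =ᵐ[volume] Q.indicator fun _ => c) :
    (normalizedLebesgue Ω).conv ν = normalizedLebesgue Q := by
  have h0 := hΩ.volume_pos.ne'
  have h1 := hΩ.volume_lt_top.ne
  have : IsProbabilityMeasure (normalizedLebesgue Ω) :=
    ProbabilityTheory.cond_isProbabilityMeasure_of_finite h0 h1
  have key : ∀ E, MeasurableSet E → ((normalizedLebesgue Ω).conv ν) E
      = (volume Ω)⁻¹ * c * volume (E ∩ Q) := by
    intro E hE
    rw [conv_normalizedLebesgue_apply hΩ.measurableSet hE,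
      lintegral_congr_ae (ae_restrict_of_ae h),
      lintegral_indicator₀ (hQ.mono_ac Measure.absolutelyContinuous_restrict), lintegral_const,
      Measure.restrict_apply_univ, Measure.restrict_apply₀' (hs := hE.nullMeasurableSet), mul_assoc,
      inter_comm]
  have huniv := key univ MeasurableSet.univ
  rw [measure_univ, univ_inter] at huniv
  have hinv : (volume Q)⁻¹ = (volume Ω)⁻¹ * c := (ENNReal.eq_inv_of_mul_eq_one_left huniv.symm).symm
  ext E hE
  rw [key E hE, normalizedLebesgue, ProbabilityTheory.cond, Measure.smul_apply, smul_eq_mul,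
    Measure.restrict_apply hE, hinv]

/-! ### Atomic structure of `ν`. -/

/-- If the convolution of a nonzero finite measure with the indicator of `Ω` takes only the values
`0` and `c`, then the measure has an atom of mass `c`. -/
theorem exists_measure_singleton_eq [IsFiniteMeasure ν] (hΩ : HasEssBounds Ω α β) (hν : ν ≠ 0)
    (hc : c ≠ 0) (h : ∀ᵐ x, ν {y | x - y ∈ Ω} = 0 ∨ ν {y | x - y ∈ Ω} = c) : ∃ y, ν {y} = c := by
  have hle : ∀ x, ν {y | x - y ∈ Ω} ≤ ν (Iic (x - α)) := fun x => measure_mono fun y hy => by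
    have := (hΩ.subset hy).1
    simp only [mem_Iic]; linarith
  -- The infimum of `Y` is the candidate atom: further left, `ν` has too little mass for the value
  -- `c` to occur.
  set Y : Set ℝ := {y | c ≤ ν (Iic y)} with hY
  have hYne : Y.Nonempty := by
    by_contra hemp
    have hf0 : ∀ᵐ x, ν {y | x - y ∈ Ω} = 0 := by
      filter_upwards [h] with x hx
      refine hx.resolve_right fun hxc => hemp ⟨x - α, ?_⟩
      exact hxc.symm.le.trans (hle x)
    have h1 := setLIntegral_measure_sub_mem (ν := ν) hΩ.measurableSet univ
    simp only [Measure.restrict_univ, inter_univ, volume_translate, lintegral_const] at h1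
    rw [lintegral_congr_ae hf0, lintegral_zero] at h1
    rcases mul_eq_zero.1 h1.symm with h2 | h2
    · exact hΩ.volume_pos.ne' h2
    · exact hν (Measure.measure_univ_eq_zero.1 h2)
  have hYb : BddBelow Y := by
    have h1 : Tendsto (fun n : ℕ => ν (Iic (-(n : ℝ)))) atTop (𝓝 0) := by
      have h2 : ⋂ n : ℕ, Iic (-(n : ℝ)) = ∅ := by
        refine eq_empty_of_forall_notMem fun x hx => ?_
        obtain ⟨n, hn⟩ := exists_nat_gt (-x)
        have := mem_iInter.1 hx n
        simp only [mem_Iic] at this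
        linarith
      have := tendsto_measure_iInter_atTop (μ := ν) (s := fun n : ℕ => Iic (-(n : ℝ)))
        (fun n => measurableSet_Iic.nullMeasurableSet)
        (fun m n hmn => Iic_subset_Iic.2 (neg_le_neg (Nat.cast_le.2 hmn)))
        ⟨0, measure_ne_top _ _⟩
      rwa [h2, measure_empty] at this
    obtain ⟨n, hn⟩ := (h1.eventually (gt_mem_nhds hc.bot_lt)).exists
    refine ⟨-n, fun y hy => ?_⟩
    by_contra! hlt
    exact (hn.trans_le hy).not_ge (measure_mono (Iic_subset_Iic.2 hlt.le))
  set y₀ := sInf Y with hy₀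
  -- The density vanishes left of `y₀ + α`. Mass at some `y < y₀` would make it positive there,
  -- because `α` is the essential infimum of `Ω`.
  have hbelow : ν (Iio y₀) = 0 := by
    have hf0 : ∀ᵐ x ∂(volume.restrict (Iio (y₀ + α))), ν {y | x - y ∈ Ω} = 0 := by
      filter_upwards [ae_restrict_of_ae h, self_mem_ae_restrict measurableSet_Iio] with x hx hxm
      refine hx.resolve_right fun hxc => ?_
      have : x - α ∈ Y := hxc.symm.le.trans (hle x)
      have := csInf_le hYb this
      have := mem_Iio.1 hxm
      linarith
    have h1 := setLIntegral_measure_sub_mem (ν := ν) hΩ.measurableSet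
      (Iio (y₀ + α))
    rw [lintegral_congr_ae hf0, lintegral_zero, eq_comm, 
      lintegral_eq_zero_iff (measurable_volume_translate_inter hΩ.measurableSet _)] at h1
    have h2 : ∀ᵐ y ∂ν, ¬ y < y₀ := by
      filter_upwards [h1] with y hy hlt
      have h3 : {x | x - y ∈ Ω} ∩ Iio (y₀ + α) = {x | x - y ∈ Ω ∩ Iio (y₀ + α - y)} := by
        ext x; simp
      rw [h3, volume_translate] at hy
      exact (hΩ.left (y₀ + α - y) (by linarith)).ne' hy
    rw [ae_iff] at h2
    simp only [not_not] at h2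
    exact h2
  have hge : c ≤ ν {y₀} := by
    refine ge_of_tendsto (tendsto_measure_Icc_nhdsWithin_right' ν y₀) ?_
    filter_upwards [self_mem_nhdsWithin] with δ hδ
    have hpos : (0 : ℝ) < δ := hδ
    obtain ⟨y, hyY, hy⟩ := exists_lt_of_csInf_lt hYne (show sInf Y < y₀ + δ by linarith)
    calc c ≤ ν (Iic y) := hyY
      _ ≤ ν (Iio y₀ ∪ Icc (y₀ - δ) (y₀ + δ)) := measure_mono fun z hz => by
        rcases lt_or_ge z y₀ with h | h
        · exact Or.inl h
        · exact Or.inr ⟨by linarith, (mem_Iic.1 hz).trans hy.le⟩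
      _ ≤ ν (Iio y₀) + ν (Icc (y₀ - δ) (y₀ + δ)) := measure_union_le _ _
      _ = ν (Icc (y₀ - δ) (y₀ + δ)) := by rw [hbelow, zero_add]
  refine ⟨y₀, le_antisymm ?_ hge⟩
  have hpos : volume {x | x - y₀ ∈ Ω} ≠ 0 := by rw [volume_translate]; exact hΩ.volume_pos.ne'
  obtain ⟨x, hx, hxc⟩ := ((frequently_ae_mem_iff.2 hpos).and_eventually h).exists
  have h1 : ν {y₀} ≤ ν {y | x - y ∈ Ω} := measure_mono (singleton_subset_iff.2 hx)
  rcases hxc with h2 | h2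
  · exact absurd (hge.trans (h1.trans_eq h2)) (by simpa using hc)
  · exact h1.trans_eq h2

/-- A finite measure whose convolution with the indicator of `Ω` takes only the values `0` and `c`
is a sum of distinct atoms of mass `c`. -/
theorem exists_eq_sum_dirac [IsFiniteMeasure ν] (hΩ : HasEssBounds Ω α β)
    (hc : c ≠ 0) (hc' : c ≠ ⊤) (h : ∀ᵐ x, ν {y | x - y ∈ Ω} = 0 ∨ ν {y | x - y ∈ Ω} = c) :
    ∃ T : Finset ℝ, ν = ∑ t ∈ T, c • Measure.dirac t := by
  obtain ⟨n, hn⟩ : ∃ n : ℕ, ν univ < n * c := by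
    obtain ⟨n, hn⟩ := ENNReal.exists_nat_mul_gt hc (measure_ne_top ν univ)
    exact ⟨n, hn⟩
  -- Each removed atom costs mass `c`, so the bound on the total mass drops by one multiple of `c`.
  induction n generalizing ν with
  | zero => simp at hn
  | succ n ih =>
    by_cases hν : ν = 0
    · exact ⟨∅, by simpa using hν⟩
    obtain ⟨y₀, hy₀⟩ := exists_measure_singleton_eq hΩ hν hc h
    have hsplit : ν = c • Measure.dirac y₀ + ν.restrict {y₀}ᶜ := by
      conv_lhs => rw [← Measure.restrict_add_restrict_compl (μ := ν) (measurableSet_singleton y₀)]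
      rw [Measure.restrict_singleton, hy₀]
    have happ : ∀ s, ν s = c * s.indicator 1 y₀ + ν.restrict {y₀}ᶜ s := fun s => by
      conv_lhs => rw [hsplit]
      simp [Measure.dirac_apply]
    have hadd : ∀ a b d : ℝ≥0∞, d ≠ ⊤ → d + a = d + b → a = b := fun a b d hd h =>
      (ENNReal.add_right_inj hd).1 h
    obtain ⟨T, hT⟩ := ih (ν := ν.restrict {y₀}ᶜ) (by
      filter_upwards [h] with x hx
      rw [happ] at hx
      -- On `y₀ + Ω` the atom already uses the whole value `c`, leaving `0`; elsewhere nothing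
      -- changes.
      by_cases hxy : x - y₀ ∈ Ω
      · left
        have : y₀ ∈ {y | x - y ∈ Ω} := hxy
        rw [indicator_of_mem this, Pi.one_apply, mul_one] at hx
        rcases hx with hx | hx
        · exact absurd (add_eq_zero.1 hx).1 hc
        · exact hadd _ _ c hc' (hx.trans (add_zero c).symm)
      · have : y₀ ∉ {y | x - y ∈ Ω} := hxy
        rwa [indicator_of_notMem this, mul_zero, zero_add] at hx) (by
      rw [happ univ] at hn
      simp only [indicator_univ, Pi.one_apply, mul_one, Nat.cast_add, Nat.cast_one, add_mul,
        one_mul] at hn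
      rw [add_comm] at hn
      exact lt_of_add_lt_add_right hn)
    have hy₀T : y₀ ∉ T := by
      intro hmem
      have h1 : ν.restrict {y₀}ᶜ {y₀} = 0 := by
        rw [Measure.restrict_apply (measurableSet_singleton _)]; simp
      rw [hT, Measure.finsetSum_apply, Finset.sum_eq_zero_iff] at h1
      have := h1 y₀ hmem
      simp [hc] at this
    exact ⟨insert y₀ T, by rw [Finset.sum_insert hy₀T, ← hT]; exact hsplit⟩

/-! ### From a factorization to a tiling. -/

theorem sum_dirac_sub_mem (T : Finset ℝ) (x : ℝ) :
    (∑ t ∈ T, c • Measure.dirac t : Measure ℝ) {y | x - y ∈ Ω}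
      = ∑ t ∈ T, Ω.indicator (fun _ => c) (x - t) := by
  classical
  rw [Measure.finsetSum_apply]
  refine Finset.sum_congr rfl fun t _ => ?_
  simp [Measure.dirac_apply, indicator_apply]

theorem isTranslationalTile_of_conv_eq [IsProbabilityMeasure ν] (hΩ : HasEssBounds Ω α β)
    {Q : Set ℝ} (hQ : IsLatticeFundamentalDomain Q)
    (h : (normalizedLebesgue Ω).conv ν = normalizedLebesgue Q) : IsTranslationalTile Ω := by
  classical
  obtain ⟨Γ, hΓd, hΓ, hfd⟩ := hQ
  obtain ⟨c, hc, hc', hf⟩ := measure_sub_mem_ae_eq_of_conv_eq hΩ hfd.nullMeasurableSet h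
  obtain ⟨T, rfl⟩ := exists_eq_sum_dirac hΩ hc hc' (by
    filter_upwards [hf] with x hx
    rw [hx]
    by_cases hxQ : x ∈ Q <;> simp [hxQ])
  simp only [sum_dirac_sub_mem] at hf
  have hcount : Countable Γ := inferInstance
  have hcov : ∀ᵐ x, x ∈ Q → ∃ t ∈ T, x - t ∈ Ω := by
    filter_upwards [hf] with x hx hxQ
    by_contra! hcon
    rw [indicator_of_mem hxQ, Finset.sum_eq_zero fun t ht => indicator_of_notMem (hcon t ht) _] at hx
    exact hc hx.symm
  have hsub : ∀ t ∈ T, ∀ᵐ x, x - t ∈ Ω → x ∈ Q := by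
    intro t ht
    filter_upwards [hf] with x hx hxt
    by_contra hxQ
    rw [indicator_of_notMem hxQ, Finset.sum_eq_zero_iff] at hx
    have := hx t ht
    rw [indicator_of_mem hxt] at this
    exact hc this
  -- An overlap would force the density up to `2c`, while it is at most `c`.
  have hdisj : ∀ t ∈ T, ∀ t' ∈ T, t ≠ t' → ∀ᵐ x, ¬ (x - t ∈ Ω ∧ x - t' ∈ Ω) := by
    intro t ht t' ht' hne
    filter_upwards [hf] with x hx ⟨h1, h2⟩
    have h3 : c + c ≤ ∑ t ∈ T, Ω.indicator (fun _ => c) (x - t) := by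
      calc c + c = ∑ s ∈ {t, t'}, Ω.indicator (fun _ => c) (x - s) := by
            rw [Finset.sum_pair hne, indicator_of_mem h1, indicator_of_mem h2]
        _ ≤ _ := Finset.sum_le_sum_of_subset (by
          intro s hs; simp only [Finset.mem_insert, Finset.mem_singleton] at hs
          rcases hs with rfl | rfl <;> assumption)
    rw [hx] at h3
    have h4 : Q.indicator (fun _ => c) x ≤ c := indicator_le_self' (by simp) x
    have h5 := h3.trans h4
    exact absurd h5 (not_le.2 (ENNReal.lt_add_right hc' hc))
  have htr : ∀ (s : ℝ) {p : ℝ → Prop}, (∀ᵐ x, p x) → ∀ᵐ x, p (x - s) := fun s p hp =>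
    (quasiMeasurePreserving_sub_right s).ae hp
  set J : Set ℝ := {s | ∃ t ∈ T, ∃ γ ∈ Γ, t + γ = s} with hJ
  have hpack : IsAEPacking Ω J := by
    rintro _ ⟨t, ht, γ, hγ, rfl⟩ _ ⟨t', ht', γ', hγ', rfl⟩ hne
    by_cases hγγ : γ = γ'
    · subst hγγ
      have hne' : t ≠ t' := fun h => hne (by rw [h])
      filter_upwards [htr γ (hdisj t ht t' ht' hne')] with x hx
      simpa only [sub_sub, add_comm] using hx
    · have h1 := hfd.aedisjoint (show (⟨γ, hγ⟩ : Γ) ≠ ⟨γ', hγ'⟩ from fun h => hγγ (congrArg Subtype.val h))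
      have h2 : ∀ᵐ x, ¬ (x - γ ∈ Q ∧ x - γ' ∈ Q) := by
        rw [ae_iff]
        simp only [not_not]
        refine measure_mono_null ?_ h1
        rintro x ⟨hx1, hx2⟩
        exact ⟨⟨x - γ, hx1, by simp [Submodule.vadd_def]⟩,
          ⟨x - γ', hx2, by simp [Submodule.vadd_def]⟩⟩
      filter_upwards [h2, htr γ (hsub t ht), htr γ' (hsub t' ht')] with x hx h3 h4 ⟨h5, h6⟩
      exact hx ⟨h3 (by rwa [sub_sub, add_comm γ t]), h4 (by rwa [sub_sub, add_comm γ' t'])⟩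
  refine (isTranslationalTile_iff Ω).2 ⟨J, isDiscrete_of_isAEPacking hΩ hpack, ?_, hpack⟩
  have h1 : ∀ᵐ x, ∀ γ : Γ, x - (-(γ : ℝ)) ∈ Q → ∃ t ∈ T, x - (-(γ : ℝ)) - t ∈ Ω :=
    ae_all_iff.2 fun γ => htr _ hcov
  filter_upwards [hfd.ae_covers, h1] with x ⟨γ, hγ⟩ hx
  obtain ⟨t, ht, htΩ⟩ := hx γ (by
    rw [sub_neg_eq_add, add_comm]; simpa [Submodule.vadd_def] using hγ)
  exact ⟨t + -(γ : ℝ), ⟨t, ht, _, Γ.neg_mem γ.2, rfl⟩, by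
    rwa [sub_sub, add_comm] at htΩ⟩

/-! ### From a tiling to a factorization. -/

/-- A tiling of the line with a recurrent window produces a fundamental domain that is a finite
union of translates of `Ω`, hence a factorization of its normalized Lebesgue measure. -/
theorem exists_conv_eq_of_tiling (hΩ : HasEssBounds Ω α β) (hc : IsAECovering Ω J)
    (hp : IsAEPacking Ω J) :
    ∃ (ν : Measure ℝ) (Q : Set ℝ), IsProbabilityMeasure ν ∧ IsLatticeFundamentalDomain Q ∧
      (normalizedLebesgue Ω).conv ν = normalizedLebesgue Q := by
  classical
  obtain ⟨a, haJ, τ, hτ, hLτ, hrec⟩ := exists_recurrent_window hΩ hc hp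
  have htr : ∀ (s : ℝ) {p : ℝ → Prop}, (∀ᵐ x, p x) → ∀ᵐ x, p (x - s) := fun s p hp =>
    (quasiMeasurePreserving_sub_right s).ae hp
  have hfin : (J ∩ Ico a (a + τ)).Finite :=
    (hp.finite_inter_Icc hΩ a (a + τ)).subset (inter_subset_inter_right _ Ico_subset_Icc_self)
  set T := hfin.toFinset with hTdef
  have hT : ∀ t, t ∈ T ↔ t ∈ J ∧ a ≤ t ∧ t < a + τ := fun t => by simp [hTdef]
  have haT : a ∈ T := (hT a).2 ⟨haJ, le_rfl, by linarith⟩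
  set Q : Set ℝ := {x | ∃ t ∈ T, x - t ∈ Ω} with hQ
  have hQm : MeasurableSet Q := by
    have : Q = ⋃ t ∈ T, (fun x => x - t) ⁻¹' Ω := by ext x; simp [hQ]
    rw [this]
    exact T.measurableSet_biUnion fun t _ => (measurable_id.sub_const t) hΩ.measurableSet
  have hcard : (T.card : ℝ≥0∞) ≠ 0 := by
    simpa using Finset.ne_empty_of_mem haT
  have hpackT : ∀ᵐ x, ∀ t ∈ T, ∀ t' ∈ T, t ≠ t' → ¬ (x - t ∈ Ω ∧ x - t' ∈ Ω) :=
    (ae_ball_iff T.countable_toSet).2 fun t ht => (ae_ball_iff T.countable_toSet).2 fun t' ht' => by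
      by_cases hne : t = t'
      · simp [hne]
      · filter_upwards [hp t ((hT t).1 ht).1 t' ((hT t').1 ht').1 hne] with x hx _ using hx
  set ν : Measure ℝ := ∑ t ∈ T, (T.card : ℝ≥0∞)⁻¹ • Measure.dirac t with hν
  have hprob : IsProbabilityMeasure ν := ⟨by
    rw [hν, Measure.finsetSum_apply]
    simp [ENNReal.mul_inv_cancel hcard (ENNReal.natCast_ne_top _)]⟩
  refine ⟨ν, Q, hprob, ?_, conv_eq_of_measure_sub_mem_ae_eq hΩ hQm.nullMeasurableSet
    (c := (T.card : ℝ≥0∞)⁻¹) ?_⟩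
  swap
  · filter_upwards [hpackT] with x hx
    rw [hν, sum_dirac_sub_mem]
    by_cases hxQ : x ∈ Q
    · obtain ⟨t, ht, hxt⟩ := hxQ
      rw [indicator_of_mem (show x ∈ Q from ⟨t, ht, hxt⟩), Finset.sum_eq_single_of_mem t ht,
        indicator_of_mem hxt]
      exact fun s hs hst => indicator_of_notMem (fun h => hx s hs t ht hst ⟨h, hxt⟩) _
    · rw [indicator_of_notMem hxQ]
      exact Finset.sum_eq_zero fun t ht => indicator_of_notMem (fun h => hxQ ⟨t, ht, h⟩) _
  let b : Module.Basis Unit ℝ ℝ :=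
    (Module.Basis.singleton Unit ℝ).unitsSMul fun _ => Units.mk0 τ hτ.ne'
  have hb : range b = {τ} := by
    rw [range_unique]; simp [b, Module.Basis.unitsSMul_apply, Units.smul_def]
  have hmem : ∀ x, x ∈ Submodule.span ℤ (range b) ↔ ∃ k : ℤ, (k : ℝ) * τ = x := fun x => by
    rw [hb, Submodule.mem_span_singleton]; simp
  refine ⟨Submodule.span ℤ (range b), inferInstance, inferInstance,
    ⟨hQm.nullMeasurableSet, ?_, ?_⟩⟩
  · have h1 : ∀ᵐ x, ∀ k : ℤ, ∃ s ∈ J, x - k * τ - s ∈ Ω := ae_all_iff.2 fun k => htr _ hc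
    filter_upwards [h1] with x hx
    -- With `x - k * τ` in this period, its covering `s ∈ J` lies in `[a - (β - α), a + τ)`. If `s <
    -- a`, recurrence replaces it by `s + τ`, which lies in `T` since `β - α ≤ τ`.
    obtain ⟨k, hk, -⟩ := existsUnique_sub_zsmul_mem_Ico hτ x (a + α)
    simp only [zsmul_eq_mul, mem_Ico] at hk
    obtain ⟨s, hsJ, hs⟩ := hx k
    have h2 := hΩ.subset hs
    have key : ∃ m : ℤ, s - m * τ ∈ T := by
      rcases le_or_gt a s with has | has
      · exact ⟨0, (hT _).2 (by
          simpa using ⟨hsJ, has, by linarith [h2.1]⟩)⟩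
      · have h3 := (hrec (s - a) (by linarith [h2.2]) (by linarith)).1 (by simpa using hsJ)
        exact ⟨-1, (hT _).2 ⟨by convert h3 using 1; push_cast; ring,
          by push_cast; linarith [h2.2], by push_cast; linarith⟩⟩
    obtain ⟨m, hm⟩ := key
    refine ⟨⟨((-(k + m) : ℤ) : ℝ) * τ, (hmem _).2 ⟨_, rfl⟩⟩, s - m * τ, hm, ?_⟩
    simp only [Submodule.vadd_def, vadd_eq_add]
    convert hs using 1
    push_cast; ring
  · rintro ⟨γ, hγ⟩ ⟨γ', hγ'⟩ hne
    obtain ⟨k, rfl⟩ := (hmem γ).1 hγ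
    obtain ⟨k', rfl⟩ := (hmem γ').1 hγ'
    have hkk : k ≠ k' := fun h => hne (by subst h; rfl)
    have hT_lt : ∀ k k' : ℤ, k < k' → ∀ t ∈ T, ∀ t' ∈ T,
        ∀ᵐ x, ¬ (x - (t + k * τ) ∈ Ω ∧ x - (t' + k' * τ) ∈ Ω) := by
      intro k k' hlt t ht t' ht'
      obtain ⟨htJ, hta, htb⟩ := (hT t).1 ht
      obtain ⟨htJ', hta', htb'⟩ := (hT t').1 ht'
      have hlt' : (k : ℝ) + 1 ≤ k' := by exact_mod_cast hlt
      have hmul : (k + 1) * τ ≤ k' * τ := mul_le_mul_of_nonneg_right hlt' hτ.le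
      rcases lt_or_ge (β - α) ((t' + k' * τ) - (t + k * τ)) with hfar | hnear
      · refine Eventually.of_forall fun x ⟨h1, h2⟩ => ?_
        linarith [(hΩ.subset h1).2, (hΩ.subset h2).1]
      -- Only adjacent periods can interact. There `t - τ` falls in the recurrent window, hence in
      -- `J`, and the overlap becomes one between two distinct members of `J`.
      · have hk1 : k' = k + 1 := by
          by_contra hne
          have h2 : (k : ℝ) + 2 ≤ k' := by
            have : k + 2 ≤ k' := by omega
            exact_mod_cast this
          have h3 := mul_le_mul_of_nonneg_right h2 hτ.le
          rw [add_mul] at h3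
          linarith
        have hs := (hrec (t - τ - a) (by subst hk1; push_cast at hnear; linarith) (by linarith)).2
          (by convert htJ using 1; ring)
        filter_upwards [htr (k' * τ) (hp _ hs _ htJ' (by intro h; linarith))] with x hx ⟨h1, h2⟩
        refine hx ⟨?_, by convert h2 using 1; ring⟩
        convert h1 using 1
        rw [hk1]; push_cast; ring
    have hall : ∀ᵐ x, ∀ t ∈ T, ∀ t' ∈ T, ¬ (x - (t + k * τ) ∈ Ω ∧ x - (t' + k' * τ) ∈ Ω) := by
      refine (ae_ball_iff T.countable_toSet).2 fun t ht =>
        (ae_ball_iff T.countable_toSet).2 fun t' ht' => ?_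
      rcases lt_or_gt_of_ne hkk with h | h
      · exact hT_lt k k' h t ht t' ht'
      · filter_upwards [hT_lt k' k h t' ht' t ht] with x hx hx' using hx hx'.symm
    rw [ae_iff] at hall
    refine measure_mono_null ?_ hall
    rintro x ⟨⟨y, ⟨t, ht, hyt⟩, rfl⟩, ⟨z, ⟨t', ht', hzt⟩, hz⟩⟩
    simp only [Submodule.vadd_def, vadd_eq_add] at hz
    intro hcon
    refine hcon t ht t' ht' ⟨?_, ?_⟩
    · simp only [Submodule.vadd_def, vadd_eq_add]
      convert hyt using 1; ring
    · simp only [Submodule.vadd_def, vadd_eq_add]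
      rw [← hz]
      convert hzt using 1; ring

/-! ### Deduction of the Fuglede conjecture. -/

theorem isCompact_support_normalizedLebesgue {E : Set ℝ} (hE : Bornology.IsBounded E)
    (hm : NullMeasurableSet E) :
    IsCompact (normalizedLebesgue E).support := by
  have h1 : (normalizedLebesgue E).support ⊆ closure E := by
    refine Measure.support_subset_of_isClosed isClosed_closure ?_
    have : E ∈ ae (volume.restrict E) := ae_restrict_mem₀ hm
    exact mem_of_superset (Measure.smul_absolutelyContinuous.ae_le this) subset_closure
  exact hE.isCompact_closure.of_isClosed_subset Measure.isClosed_support h1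

theorem theorem4p2 (h : GeneralizedFugledeConjecture) : FugledeConjecture := by
  intro E hb hm hpos
  have hlt : volume E < ⊤ := hb.measure_lt_top
  have hprob : IsProbabilityMeasure (normalizedLebesgue E) :=
    ProbabilityTheory.cond_isProbabilityMeasure_of_finite hpos.ne' hlt.ne
  have hiff := h _ hprob (isCompact_support_normalizedLebesgue hb hm)
  obtain ⟨Ω, α, β, he, hΩ⟩ := exists_hasEssBounds hb hm hpos
  have hnorm : normalizedLebesgue E = normalizedLebesgue Ω := by
    unfold normalizedLebesgue ProbabilityTheory.cond
    rw [measure_congr he, Measure.restrict_congr_set he]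
  constructor
  · rintro ⟨-, -, -, hs⟩
    obtain ⟨ν, Q, hν, hQ, hconv⟩ := hiff.1 hs
    rw [hnorm] at hconv
    exact isTranslationalTile_congr he (isTranslationalTile_of_conv_eq hΩ hQ hconv)
  · intro ht
    refine ⟨hm, hpos, hlt, hiff.2 ?_⟩
    obtain ⟨J, -, hc, hp⟩ := (isTranslationalTile_iff Ω).1 (isTranslationalTile_congr he.symm ht)
    rw [hnorm]
    exact exists_conv_eq_of_tiling hΩ hc hp
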